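/- A partition is a finite weakly decreasing sequence $\lambda=(\lambda_1\ge\lambda_2\ge\dots\ge\lambda_\ell)$ of positive integers; $\ell$ is its length, and it is a partition of $n$ if its parts sum to $n$. The empty sequence, of length $0$, is the only partition of $0$. A partition is strict if its parts are pairwise distinct. Let $\mathcal{P}_4$ be the set of strict partitions $\lambda$ such that for all $1\le i<\ell$ 1. $\lambda_i-\lambda_{i+1}\equiv 2 \pmod 4$ if $\lambda_i$ and $\lambda_{i+1}$ are both odd; 2. $\lambda_i-\lambda_{i+1}\equiv 0 \pmod 4$ if $\lambda_i$ and $\lambda_{i+1}$ are both even; 3. $\lambda_i-\lambda_{i+1}\equiv 3 \pmod 4$ if $\lambda_i$ and $\lambda_{i+1}$ have different parity; and such that the smallest part $\lambda_\ell$ (if $\ell\ge1$) is congruent to $1$ or $2$ modulo $4$. In particular, the empty partition belongs to $\mathcal{P}_4$. Let $\mathcal{S}_4$ be the set of strict partitions none of whose parts is a multiple of $4$; it also contains the empty partition. For $n\ge0$, let $P_{4,e}(n)$ and $P_{4,o}(n)$ be the number of partitions of $n$ in $\mathcal{P}_4$ with even length and with odd length, respectively, and let $S_{4,e}(n)$ and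 $S_{4,o}(n)$ be the number of partitions of $n$ in $\mathcal{S}_4$ with even length and with odd length, respectively. Then for every $n\ge 0$, $$P_{4,e}(n)-P_{4,o}(n)=S_{4,e}(n)-S_{4,o}(n).$$ -/

import Mathlib

namespace GapMod4

/-- The gap condition on a larger part `a` followed by the next smaller part `b`: modulo `4`,
`a - b` is `2` if both are odd, `0` if both are even, and `3` if their parities differ.
The difference is taken in `ℤ`. -/
def Gap (a b : ℕ) : Prop :=
  (Odd a ∧ Odd b → (a : ℤ) - (b : ℤ) ≡ 2 [ZMOD 4]) ∧
  (Even a ∧ Even b → (a : ℤ) - (b : ℤ) ≡ 0 [ZMOD 4]) ∧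
  (¬(Even a ↔ Even b) → (a : ℤ) - (b : ℤ) ≡ 3 [ZMOD 4])

instance : DecidableRel Gap := fun a b => by unfold Gap; infer_instance

/-- The parts of a partition in weakly decreasing order. -/
def partList {n : ℕ} (p : n.Partition) : List ℕ := p.parts.sort (· ≥ ·)

/-- The class `𝒫₄`: strict partitions in which every two consecutive parts satisfy the gap
condition and the smallest part, if there is one, is `1` or `2` modulo `4`. -/
def IsP4 {n : ℕ} (p : n.Partition) : Prop :=
  p.parts.Nodup ∧ (partList p).IsChain Gap ∧
    ∀ m ∈ p.parts, (∀ k ∈ p.parts, m ≤ k) → m ≡ 1 [MOD 4] ∨ m ≡ 2 [MOD 4]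

instance {n : ℕ} : DecidablePred (IsP4 (n := n)) := fun p => by unfold IsP4; infer_instance

/-- The class `𝒮₄`: strict partitions none of whose parts is a multiple of `4`. -/
def IsS4 {n : ℕ} (p : n.Partition) : Prop :=
  p.parts.Nodup ∧ ∀ m ∈ p.parts, ¬ 4 ∣ m

instance {n : ℕ} : DecidablePred (IsS4 (n := n)) := fun p => by unfold IsS4; infer_instance

/-- The length (number of parts, with multiplicity) of a partition. -/
def length {n : ℕ} (p : n.Partition) : ℕ := p.parts.card

/-- Partitions of `n` in `𝒫₄` of even length. -/
def P4e (n : ℕ) : Finset n.Partition := {p | IsP4 p ∧ Even (length p)}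

/-- Partitions of `n` in `𝒫₄` of odd length. -/
def P4o (n : ℕ) : Finset n.Partition := {p | IsP4 p ∧ Odd (length p)}

/-- Partitions of `n` in `𝒮₄` of even length. -/
def S4e (n : ℕ) : Finset n.Partition := {p | IsS4 p ∧ Even (length p)}

/-- Partitions of `n` in `𝒮₄` of odd length. -/
def S4o (n : ℕ) : Finset n.Partition := {p | IsS4 p ∧ Odd (length p)}

end GapMod4

/-! Let `G_k` be the generating function of the members of 𝒫₄ with `k` parts. Removing or lowering
the smallest part gives `G_{k+1} (1 - q^{4k+4}) = q^{2k+1} (1 + q^{2k+1}) G_k`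
(`listGenFun_goodLists_succ`), so `G_k = q^{k²} (-q; q²)_k / (q⁴; q⁴)_k`. The signed count for 𝒮₄
has generating function `(q; q²)_∞ (q²; q⁴)_∞`, so what remains is `slater_identity`.

For that, put `F_m = ∑ (-1)^l q^{2ml} G_l (-q²; q²)_l / (-q²; q²)_{m+l}`. A telescoping sum gives
`F_m = (1 - q^{2m+1}) F_{m+1}`, and `F_m` is multiplied by a fixed product to clear denominators.
Iterating from `m = 0` produces `(q; q²)_∞`; the factor `1 / (-q²; q²)_∞` left over is `(q²; q⁴)_∞`
by Euler. Convergence is replaced by working modulo `q^N`. -/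

namespace GapMod4

open Finset

/-! ### The q-series identity, over a ring with nilpotent `q`. -/

section SlaterIdentity

variable {R : Type*} [CommRing R]

/-- A truncation of `(-q²; q²)_∞ (q²; q⁴)_∞ = 1`. -/
theorem prod_one_add_mul_prod_one_sub (q : R) (K : ℕ) :
    (∏ j ∈ range (2 * K), (1 + q ^ (2 * j + 2))) * ∏ m ∈ range K, (1 - q ^ (4 * m + 2)) =
      ∏ j ∈ Ico K (2 * K), (1 - q ^ (4 * j + 4)) := by
  induction K with
  | zero => simp
  | succ K ih =>
    rcases Nat.eq_zero_or_pos K with rfl | hK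
    · simp [prod_range_succ]
      ring
    -- The lower factor `1 - q^{4K+4}` must leave the product; it combines with the new factors
    -- through `(1 - x)(1 + x) = 1 - x²`.
    · rw [prod_eq_prod_Ico_succ_bot (by lia)] at ih
      rw [show 2 * (K + 1) = 2 * K + 1 + 1 by ring, prod_range_succ, prod_range_succ,
        prod_range_succ, prod_Ico_succ_top (by lia), prod_Ico_succ_top (by lia)]
      have h : ((∏ j ∈ range (2 * K), (1 + q ^ (2 * j + 2))) * (1 + q ^ (2 * (2 * K) + 2)) *
          (1 + q ^ (2 * (2 * K + 1) + 2))) *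
          ((∏ m ∈ range K, (1 - q ^ (4 * m + 2))) * (1 - q ^ (4 * K + 2))) =
          ((∏ j ∈ range (2 * K), (1 + q ^ (2 * j + 2))) * ∏ m ∈ range K, (1 - q ^ (4 * m + 2))) *
          ((1 + q ^ (2 * (2 * K) + 2)) * (1 + q ^ (2 * (2 * K + 1) + 2)) *
            (1 - q ^ (4 * K + 2))) := by ring
      rw [h, ih]
      ring

variable (q : R) (P : ℕ → R)

/-- The numerators of the terms of the sum, after multiplication by `(-q²; q²)_l`. -/
def slaterNum (l : ℕ) : R := (-1) ^ l * P l * ∏ j ∈ range l, (1 + q ^ (2 * j + 2))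

/-- The terms of the `m`-shifted sum, with denominators cleared by `(-q²; q²)_B`. -/
def slaterTerm (B m l : ℕ) : R :=
  q ^ (2 * m * l) * slaterNum q P l * ∏ j ∈ Ico (m + l) B, (1 + q ^ (2 * j + 2))

variable {q P}

theorem slaterNum_succ
    (hP : ∀ l, P (l + 1) * (1 - q ^ (4 * l + 4)) = q ^ (2 * l + 1) * (1 + q ^ (2 * l + 1)) * P l)
    (l : ℕ) : slaterNum q P (l + 1) * (1 - q ^ (2 * l + 2)) =
      -(q ^ (2 * l + 1) * (1 + q ^ (2 * l + 1)) * slaterNum q P l) := by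
  have h : slaterNum q P (l + 1) * (1 - q ^ (2 * l + 2)) =
      -((-1) ^ l * (P (l + 1) * (1 - q ^ (4 * l + 4))) *
        ∏ j ∈ range l, (1 + q ^ (2 * j + 2))) := by
    rw [slaterNum, prod_range_succ]
    ring
  rw [h, hP, slaterNum]
  ring

/-- Up to a common factor this is `(1 + q^{2m+2l+2}) - (1 - q^{2m+1}) q^{2l} = (1 - q^{2l})(1 +
q^{2m+2l+2}) + q^{2m+2l+1}(1 + q^{2l+1})`. -/
theorem slaterTerm_sub
    (hP : ∀ l, P (l + 1) * (1 - q ^ (4 * l + 4)) = q ^ (2 * l + 1) * (1 + q ^ (2 * l + 1)) * P l)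
    {B m l : ℕ} (h : m + l < B) :
    slaterTerm q P B m l - (1 - q ^ (2 * m + 1)) * slaterTerm q P B (m + 1) l =
      slaterTerm q P B m l * (1 - q ^ (2 * l)) -
        slaterTerm q P B m (l + 1) * (1 - q ^ (2 * (l + 1))) := by
  have h1 : slaterTerm q P B m (l + 1) * (1 - q ^ (2 * (l + 1))) =
      q ^ (2 * m * (l + 1)) * (slaterNum q P (l + 1) * (1 - q ^ (2 * l + 2))) *
        ∏ j ∈ Ico (m + l + 1) B, (1 + q ^ (2 * j + 2)) := by
    rw [slaterTerm, ← add_assoc]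
    ring
  rw [h1, slaterNum_succ hP, slaterTerm, slaterTerm, prod_eq_prod_Ico_succ_bot h,
    show m + 1 + l = m + l + 1 by ring]
  ring

/-- Summing over `l < L`, the `m`-shifted and the `(m + 1)`-shifted sums are proportional. -/
theorem sum_slaterTerm
    (hP : ∀ l, P (l + 1) * (1 - q ^ (4 * l + 4)) = q ^ (2 * l + 1) * (1 + q ^ (2 * l + 1)) * P l)
    {B m L : ℕ} (h : m + L ≤ B) (hL : P L = 0) :
    ∑ l ∈ range L, slaterTerm q P B m l =
      (1 - q ^ (2 * m + 1)) * ∑ l ∈ range L, slaterTerm q P B (m + 1) l := by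
  rw [← sub_eq_zero, mul_sum, ← sum_sub_distrib,
    sum_congr rfl fun l hl => slaterTerm_sub hP (by have := mem_range.1 hl; lia),
    sum_range_sub' (fun l => slaterTerm q P B m l * (1 - q ^ (2 * l)))]
  -- The lower boundary term vanishes since `1 - q^0 = 0`, the upper one since `P L = 0`.
  simp [slaterTerm, slaterNum, hL]

theorem prod_eq_one_of_pow_eq_zero {N : ℕ} (hq : q ^ N = 0) (f : ℕ → ℕ) (s : Finset ℕ)
    (hf : ∀ j ∈ s, N ≤ f j) (c : R) : ∏ j ∈ s, (1 + c * q ^ f j) = 1 :=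
  prod_eq_one fun j hj => by rw [pow_eq_zero_of_le (hf j hj) hq, mul_zero, add_zero]

theorem eq_zero_of_recurrence {N : ℕ} (hq : q ^ N = 0)
    (hP : ∀ l, P (l + 1) * (1 - q ^ (4 * l + 4)) = q ^ (2 * l + 1) * (1 + q ^ (2 * l + 1)) * P l) :
    P N = 0 := by
  have h : ∀ l, q ^ l ∣ P l := by
    intro l
    induction l with
    | zero => simp
    | succ l ih =>
      have hu : IsUnit (1 - q ^ (4 * l + 4)) :=
        IsNilpotent.isUnit_one_sub ⟨N, by
          rw [← pow_mul]; exact pow_eq_zero_of_le (Nat.le_mul_of_pos_left _ (by lia)) hq⟩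
      rw [← hu.dvd_mul_right, hP, pow_succ, mul_comm (q ^ l)]
      exact mul_dvd_mul ((dvd_pow_self q (by lia)).mul_right _) ih
  simpa [hq] using h N

/-- The identity `∑ (-1)^l q^{l²} (-q; q²)_l / (q⁴; q⁴)_l = (q; q²)_∞ (q²; q⁴)_∞`, in a ring in
which `q ^ N = 0`. -/
theorem slater_identity {N : ℕ} (hq : q ^ N = 0) (hP0 : P 0 = 1)
    (hP : ∀ l, P (l + 1) * (1 - q ^ (4 * l + 4)) = q ^ (2 * l + 1) * (1 + q ^ (2 * l + 1)) * P l) :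
    ∑ l ∈ range N, (-1) ^ l * P l =
      (∏ m ∈ range N, (1 - q ^ (2 * m + 1))) * ∏ m ∈ range N, (1 - q ^ (4 * m + 2)) := by
  have hN := eq_zero_of_recurrence hq hP
  have step : ∀ M ≤ N, ∑ l ∈ range N, slaterTerm q P (2 * N) 0 l =
      (∏ m ∈ range M, (1 - q ^ (2 * m + 1))) * ∑ l ∈ range N, slaterTerm q P (2 * N) M l := by
    intro M hM
    induction M with
    | zero => simp
    | succ M ih =>
      rw [ih (by lia), prod_range_succ, sum_slaterTerm hP (by lia) hN, mul_assoc]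
  have hlast : ∑ l ∈ range N, slaterTerm q P (2 * N) N l = 1 := by
    rcases Nat.eq_zero_or_pos N with rfl | hpos
    · simpa using hq.symm
    -- For `l ≥ 1` the factor `q^{2Nl}` is already zero.
    · rw [sum_eq_single_of_mem 0 (mem_range.2 hpos)]
      · simpa [slaterTerm, slaterNum, hP0] using
          prod_eq_one_of_pow_eq_zero hq (fun j => 2 * j + 2) (Ico N (2 * N))
            (fun j hj => by have := mem_Ico.1 hj; lia) 1
      · intro l _ hl
        rw [slaterTerm, pow_eq_zero_of_le _ hq, zero_mul, zero_mul]
        have : 1 ≤ l := by lia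
        nlinarith
  have hfirst : ∑ l ∈ range N, slaterTerm q P (2 * N) 0 l =
      (∏ j ∈ range (2 * N), (1 + q ^ (2 * j + 2))) * ∑ l ∈ range N, (-1) ^ l * P l := by
    rw [mul_sum]
    refine sum_congr rfl fun l hl => ?_
    rw [← prod_range_mul_prod_Ico _ (show l ≤ 2 * N by have := mem_range.1 hl; lia), slaterTerm,
      slaterNum, zero_add]
    ring
  have hinv := prod_one_add_mul_prod_one_sub q N
  have hone := prod_eq_one_of_pow_eq_zero hq (fun j => 4 * j + 4) (Ico N (2 * N))
            (fun j hj => by have := mem_Ico.1 hj; lia) (-1)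
  simp only [neg_one_mul, ← sub_eq_add_neg] at hone
  rw [hone] at hinv
  have hmain := step N le_rfl
  rw [hlast, mul_one, hfirst] at hmain
  rw [← hmain, mul_right_comm, hinv, one_mul]

end SlaterIdentity

end GapMod4

namespace GapMod4

open PowerSeries

/-! ### Decomposition of 𝒫₄ by smallest part. -/

/-- The gap condition read upwards: the part `b` is followed by the larger part `a`. -/
def GapUp (b a : ℕ) : Prop := b < a ∧ Gap a b

theorem gapUp_iff {b a : ℕ} : GapUp b a ↔ b < a ∧
    (a % 2 = 1 ∧ b % 2 = 1 ∧ (b + 2) % 4 = a % 4 ∨ a % 2 = 0 ∧ b % 2 = 0 ∧ b % 4 = a % 4 ∨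
      a % 2 ≠ b % 2 ∧ (b + 3) % 4 = a % 4) := by
  simp only [GapUp, Gap, Int.ModEq, Nat.odd_iff, Nat.even_iff]
  omega

/-- The lists of parts, in increasing order, of the partitions in `𝒫₄`. -/
def GoodList (l : List ℕ) : Prop := l.IsChain GapUp ∧ ∀ m ∈ l.head?, m % 4 = 1 ∨ m % 4 = 2

/-- The good lists with `k` entries. -/
def goodLists (k : ℕ) : Set (List ℕ) := {l | GoodList l ∧ l.length = k}

theorem GoodList.pairwise {l : List ℕ} (h : GoodList l) : l.Pairwise (· < ·) :=
  List.isChain_iff_pairwise.1 (h.1.imp fun _ _ h => h.1)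

theorem GoodList.pos {l : List ℕ} (h : GoodList l) {m : ℕ} (hm : m ∈ l) : 0 < m := by
  cases l with
  | nil => simp at hm
  | cons a t =>
    have ha : a % 4 = 1 ∨ a % 4 = 2 := h.2 a (by simp)
    rcases List.mem_cons.1 hm with rfl | hm
    · lia
    · exact (Nat.zero_le a).trans_lt ((List.pairwise_cons.1 h.pairwise).1 m hm)

theorem goodList_map_add_four {l : List ℕ} : GoodList (l.map (· + 4)) ↔ GoodList l := by
  have h : ∀ b a, GapUp (b + 4) (a + 4) ↔ GapUp b a := fun b a => by
    simp only [gapUp_iff]; lia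
  simp only [GoodList, List.isChain_map, h, List.head?_map, Option.mem_map, forall_exists_index,
    and_imp, forall_apply_eq_imp_iff₂, Nat.add_mod_right]

/-- The gap rule is invariant under a common shift. The part after `1` must be `3` or `0` modulo
`4`, which a shift by `2` turns into the condition on a smallest part. -/
theorem goodList_one_cons {l : List ℕ} : GoodList (1 :: l.map (· + 2)) ↔ GoodList l := by
  have h : ∀ b a, GapUp (b + 2) (a + 2) ↔ GapUp b a := fun b a => by
    simp only [gapUp_iff]; lia
  have h1 : ∀ a, GapUp 1 (a + 2) ↔ (a % 4 = 1 ∨ a % 4 = 2) := fun a => by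
    rw [gapUp_iff]; lia
  obtain _ | ⟨a, t⟩ := l
  · simp [GoodList]
  · have ht := List.isChain_map (R := GapUp) (· + 2) (l := a :: t)
    simp only [h, List.map_cons] at ht
    simp [GoodList, List.isChain_cons_cons, h1, ht, and_comm]

theorem goodList_two_cons {l : List ℕ} : GoodList (2 :: l.map (· + 4)) ↔ GoodList l := by
  have h : ∀ b a, GapUp (b + 4) (a + 4) ↔ GapUp b a := fun b a => by
    simp only [gapUp_iff]; lia
  have h1 : ∀ a, GapUp 2 (a + 4) ↔ (a % 4 = 1 ∨ a % 4 = 2) := fun a => by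
    rw [gapUp_iff]; lia
  obtain _ | ⟨a, t⟩ := l
  · simp [GoodList]
  · have ht := List.isChain_map (R := GapUp) (· + 4) (l := a :: t)
    simp only [h, List.map_cons] at ht
    simp [GoodList, List.isChain_cons_cons, h1, ht, and_comm]

theorem exists_eq_map_add {k : ℕ} {l : List ℕ} (h : ∀ m ∈ l, k ≤ m) :
    ∃ t : List ℕ, l = t.map (· + k) :=
  ⟨l.map (· - k), by
    rw [List.map_map]
    conv_lhs => rw [← List.map_id l]
    exact List.map_congr_left fun m hm => (Nat.sub_add_cancel (h m hm)).symm⟩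

theorem goodLists_succ (k : ℕ) : goodLists (k + 1) =
    List.map (· + 4) '' goodLists (k + 1) ∪
      ((fun l => 1 :: l.map (· + 2)) '' goodLists k ∪
        (fun l => 2 :: l.map (· + 4)) '' goodLists k) := by
  ext l
  constructor
  · rintro ⟨hl, hk⟩
    obtain _ | ⟨a, t⟩ := l
    · simp at hk
    have ha : a % 4 = 1 ∨ a % 4 = 2 := hl.2 a (by simp)
    have hlt := (List.pairwise_cons.1 hl.pairwise).1
    simp only [List.length_cons, Nat.add_right_cancel_iff] at hk
    by_cases h1 : a = 1
    · subst h1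
      obtain ⟨s, rfl⟩ := exists_eq_map_add (k := 2) (l := t) hlt
      exact .inr (.inl ⟨s, ⟨goodList_one_cons.1 hl, by simpa using hk⟩, rfl⟩)
    by_cases h2 : a = 2
    · subst h2
      -- The part after `2` exceeds `2` and is `1` or `2` modulo `4`, so it is at least `5`.
      have h4 : ∀ m ∈ t, 4 ≤ m := by
        obtain _ | ⟨b, s⟩ := t
        · simp
        have hb : GapUp 2 b := (List.isChain_cons_cons.1 hl.1).1
        rw [gapUp_iff] at hb
        have hs := (List.pairwise_cons.1 (List.pairwise_cons.1 hl.pairwise).2).1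
        intro m hm
        rcases List.mem_cons.1 hm with rfl | hm
        · lia
        · have := hs m hm
          lia
      obtain ⟨s, rfl⟩ := exists_eq_map_add h4
      exact .inr (.inr ⟨s, ⟨goodList_two_cons.1 hl, by simpa using hk⟩, rfl⟩)
    · have h4 : ∀ m ∈ a :: t, 4 ≤ m := by
        intro m hm
        rcases List.mem_cons.1 hm with rfl | hm
        · lia
        · have := hlt m hm
          lia
      obtain ⟨s, hs⟩ := exists_eq_map_add h4
      refine .inl ⟨s, ⟨goodList_map_add_four.1 (hs ▸ hl), ?_⟩, hs.symm⟩
      simpa [hk] using (congrArg List.length hs).symm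
  · rintro (⟨s, ⟨hs, hk⟩, rfl⟩ | ⟨s, ⟨hs, hk⟩, rfl⟩ | ⟨s, ⟨hs, hk⟩, rfl⟩)
    · exact ⟨goodList_map_add_four.2 hs, by simpa using hk⟩
    · exact ⟨goodList_one_cons.2 hs, by simpa using hk⟩
    · exact ⟨goodList_two_cons.2 hs, by simpa using hk⟩

/-! ### Generating functions and their recurrence. -/

/-- The generating function, by sum, of a set of lists of natural numbers. -/
noncomputable def listGenFun (S : Set (List ℕ)) : PowerSeries ℤ :=
  .mk fun n => ({l ∈ S | l.sum = n}.ncard : ℤ)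

theorem listGenFun_image {S : Set (List ℕ)} {f : List ℕ → List ℕ} {d : ℕ}
    (hf : Function.Injective f) (hd : ∀ l ∈ S, (f l).sum = l.sum + d) :
    listGenFun (f '' S) = X ^ d * listGenFun S := by
  ext n
  rw [coeff_X_pow_mul', listGenFun, listGenFun, coeff_mk, coeff_mk]
  split_ifs with h
  · rw [← Set.ncard_image_of_injective {l ∈ S | l.sum = n - d} hf]
    congr 2
    ext l
    constructor
    · rintro ⟨⟨t, ht, rfl⟩, hn⟩
      exact ⟨t, ⟨ht, by rw [hd t ht] at hn; lia⟩, rfl⟩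
    · rintro ⟨t, ⟨ht, hn⟩, rfl⟩
      exact ⟨⟨t, ht, rfl⟩, by rw [hd t ht]; lia⟩
  · rw [Nat.cast_eq_zero]
    convert Set.ncard_empty (List ℕ)
    refine Set.eq_empty_of_forall_notMem ?_
    rintro _ ⟨⟨t, ht, rfl⟩, hn⟩
    rw [hd t ht] at hn
    lia

theorem listGenFun_union {S T : Set (List ℕ)} (h : Disjoint S T)
    (hS : ∀ n, {l ∈ S | l.sum = n}.Finite) (hT : ∀ n, {l ∈ T | l.sum = n}.Finite) :
    listGenFun (S ∪ T) = listGenFun S + listGenFun T := by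
  ext n
  simp only [listGenFun, map_add, coeff_mk]
  rw [← Nat.cast_add, ← Set.ncard_union_eq (h.mono (fun _ h => h.1) fun _ h => h.1) (hS n) (hT n)]
  congr 2
  ext l
  simp only [Set.mem_ofPred_eq, Set.mem_union]
  tauto

/-- Needed for additivity, because `ncard` is `0` on infinite sets. -/
theorem finite_goodLists_sum (k n : ℕ) : {l ∈ goodLists k | l.sum = n}.Finite := by
  refine ((List.finite_length_eq (Fin (n + 1)) k).image (List.map Fin.val)).subset ?_
  rintro l ⟨⟨-, hk⟩, hn⟩
  have h : ∀ m ∈ l, m < n + 1 := fun m hm => Nat.lt_succ_of_le (hn ▸ List.le_sum_of_mem hm)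
  refine ⟨l.pmap (fun m hm => ⟨m, hm⟩) h, by simpa using hk, ?_⟩
  simp [List.map_pmap]

theorem sum_map_add (l : List ℕ) (c : ℕ) : (l.map (· + c)).sum = l.sum + c * l.length := by
  induction l with
  | nil => simp
  | cons a t ih => simp [ih]; ring

theorem listGenFun_goodLists_zero : listGenFun (goodLists 0) = 1 := by
  ext n
  rw [listGenFun, coeff_mk, coeff_one]
  split_ifs with h
  · subst h
    rw [Nat.cast_eq_one, Set.ncard_eq_one]
    refine ⟨[], Set.ext fun l => ⟨fun hl => List.length_eq_zero_iff.1 hl.1.2, ?_⟩⟩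
    rintro rfl
    simp [goodLists, GoodList]
  · rw [Nat.cast_eq_zero]
    convert Set.ncard_empty (List ℕ)
    refine Set.eq_empty_of_forall_notMem ?_
    rintro l ⟨⟨-, hl⟩, hn⟩
    rw [List.length_eq_zero_iff.1 hl] at hn
    exact h hn.symm

theorem listGenFun_goodLists_succ (k : ℕ) :
    listGenFun (goodLists (k + 1)) * (1 - X ^ (4 * k + 4)) =
      X ^ (2 * k + 1) * (1 + X ^ (2 * k + 1)) * listGenFun (goodLists k) := by
  have hinj : ∀ c : ℕ, Function.Injective (List.map (· + c)) := fun c =>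
    List.map_injective_iff.2 (add_left_injective c)
  have hA := listGenFun_image (S := goodLists (k + 1)) (d := 4 * k + 4) (hinj 4)
    fun l hl => by rw [sum_map_add, hl.2]; ring
  have hB := listGenFun_image (S := goodLists k) (f := fun l => 1 :: l.map (· + 2))
    (d := 2 * k + 1) (fun _ _ h => hinj 2 (List.cons.inj h).2)
    fun l hl => by rw [List.sum_cons, sum_map_add, hl.2]; ring
  have hC := listGenFun_image (S := goodLists k) (f := fun l => 2 :: l.map (· + 4))
    (d := 4 * k + 2) (fun _ _ h => hinj 4 (List.cons.inj h).2)
    fun l hl => by rw [List.sum_cons, sum_map_add, hl.2]; ring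
  have hsub := (goodLists_succ k).ge
  have hfin : ∀ {T : Set (List ℕ)}, T ⊆ goodLists (k + 1) → ∀ n, {l ∈ T | l.sum = n}.Finite :=
    fun hT n => (finite_goodLists_sum (k + 1) n).subset fun _ h => ⟨hT h.1, h.2⟩
  have hBC : listGenFun _ = _ := listGenFun_union
    (S := (fun l => 1 :: l.map (· + 2)) '' goodLists k)
    (T := (fun l => 2 :: l.map (· + 4)) '' goodLists k)
    (Set.disjoint_left.2 (by rintro _ ⟨s, -, rfl⟩ ⟨t, -, h⟩; simp at h))
    (hfin ((Set.subset_union_left.trans Set.subset_union_right).trans hsub))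
    (hfin ((Set.subset_union_right.trans Set.subset_union_right).trans hsub))
  have hABC := listGenFun_union (S := List.map (· + 4) '' goodLists (k + 1))
    (T := (fun l => 1 :: l.map (· + 2)) '' goodLists k ∪
      (fun l => 2 :: l.map (· + 4)) '' goodLists k)
    (Set.disjoint_left.2 (by
      rintro _ ⟨s, hs, rfl⟩ (⟨t, -, h⟩ | ⟨t, -, h⟩) <;>
      · obtain _ | ⟨a, s⟩ := s
        · simp at h
        · have := (List.cons.inj h).1
          lia))
    (hfin (Set.subset_union_left.trans hsub)) (hfin (Set.subset_union_right.trans hsub))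
  rw [← goodLists_succ, hA, hBC, hB, hC] at hABC
  linear_combination hABC

/-! ### From partitions to coefficients. -/

/-- The partitions in `𝒫₄` of `n` with `k` parts correspond to the good lists. -/
theorem card_isP4_length (n k : ℕ) :
    (({p | IsP4 p ∧ length p = k} : Finset n.Partition).card : ℤ) =
      coeff n (listGenFun (goodLists k)) := by
  rw [listGenFun, coeff_mk, ← Set.ncard_coe_finset, Nat.cast_inj]
  refine Set.ncard_congr (fun p _ => (partList p).reverse) ?_ ?_ ?_
  · intro p hp
    obtain ⟨⟨hnd, hch, hmin⟩, hk⟩ := (Finset.mem_filter.1 hp).2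
    have hcoe : ((partList p : List ℕ) : Multiset ℕ) = p.parts := Multiset.sort_eq _ _
    have hsort : (partList p).Pairwise (· ≥ ·) := Multiset.pairwise_sort _ _
    have hnd' : (partList p).Nodup := by rwa [← Multiset.coe_nodup, hcoe]
    refine ⟨⟨⟨?_, ?_⟩, ?_⟩, ?_⟩
    · rw [List.isChain_reverse]
      have hgt : (partList p).IsChain (· > ·) :=
        (hsort.and hnd').isChain.imp fun a b h => lt_of_le_of_ne h.1 (Ne.symm h.2)
      rw [List.isChain_iff_getElem] at *
      exact fun i hi => ⟨hgt i hi, hch i hi⟩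
    · intro m hm
      have hmem : ∀ x, x ∈ (partList p).reverse ↔ x ∈ p.parts := fun x => by
        rw [List.mem_reverse, ← hcoe, Multiset.mem_coe]
      refine hmin m ((hmem m).1 (List.mem_of_mem_head? hm)) fun x hx => ?_
      rw [← hmem] at hx
      have hr : (partList p).reverse.Pairwise (· ≤ ·) := List.pairwise_reverse.2 hsort
      generalize (partList p).reverse = l at *
      obtain _ | ⟨a, t⟩ := l
      · simp at hx
      obtain rfl : a = m := by simpa using hm
      rcases List.mem_cons.1 hx with rfl | hx
      · exact le_rfl
      · exact (List.pairwise_cons.1 hr).1 x hx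
    · rw [List.length_reverse, ← Multiset.coe_card, hcoe]
      exact hk
    · rw [List.sum_reverse, ← Multiset.sum_coe, hcoe, p.parts_sum]
  · intro p p' _ _ h
    have h' : ((partList p : List ℕ) : Multiset ℕ) = partList p' :=
      congrArg _ (List.reverse_injective h)
    rw [partList, partList, Multiset.sort_eq, Multiset.sort_eq] at h'
    exact Nat.Partition.ext h'
  · rintro l ⟨⟨hl, hk⟩, hn⟩
    have hp : (l.reverse).Pairwise (· ≥ ·) :=
      List.pairwise_reverse.2 (hl.pairwise.imp fun h => le_of_lt h)
    let p : n.Partition := ⟨(l.reverse : List ℕ), fun {i} hi => hl.pos (by simpa using hi),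
      by simpa using hn⟩
    have hpl : partList p = l.reverse :=
      List.Perm.eq_of_pairwise' (Multiset.pairwise_sort _ _) hp
        (Multiset.coe_eq_coe.1 (Multiset.sort_eq _ _))
    refine ⟨p, Finset.mem_coe.2 (Finset.mem_filter.2 ⟨Finset.mem_univ _, ⟨?_, ?_, ?_⟩, ?_⟩), ?_⟩
    · exact Multiset.coe_nodup.2 (List.nodup_reverse.2 (hl.pairwise.imp fun h => ne_of_lt h))
    · rw [hpl, List.isChain_reverse]
      exact hl.1.imp fun _ _ h => h.2
    · intro m hm hle
      obtain _ | ⟨a, t⟩ := l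
      · simp [p] at hm
      have ha : a % 4 = 1 ∨ a % 4 = 2 := hl.2 a (by simp)
      have hle' : m ≤ a := hle a (by simp [p])
      have : a ≤ m := by
        have hm' : m ∈ a :: t := by simpa [p, or_comm] using hm
        rcases List.mem_cons.1 hm' with rfl | hm'
        · exact le_rfl
        · exact ((List.pairwise_cons.1 hl.pairwise).1 m hm').le
      obtain rfl : a = m := le_antisymm this hle'
      exact ha
    · simpa [p, length] using hk
    · rw [hpl, List.reverse_reverse]

/-- The partitions of `n` in `𝒮₄`, with signs, are counted by `∏ (1 - X ^ m)` over the `m` not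
divisible by `4`. -/
theorem coeff_prod_one_sub (n : ℕ) (s : Finset ℕ) (hs : ∀ m ≤ n, m ∈ s ↔ ¬ 4 ∣ m) :
    coeff n (∏ m ∈ s, (1 - (X : PowerSeries ℤ) ^ m)) =
      ∑ p : n.Partition with IsS4 p, (-1) ^ length p := by
  have h : ∏ m ∈ s, (1 - (X : PowerSeries ℤ) ^ m) =
      ∑ t ∈ s.powerset, (-1) ^ t.card * X ^ (∑ m ∈ t, m) := by
    simp_rw [sub_eq_add_neg, Finset.prod_one_add]
    refine Finset.sum_congr rfl fun t _ => ?_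
    rw [Finset.prod_neg, Finset.prod_pow_eq_pow_sum]
  rw [h, map_sum]
  have h2 : ∀ t ∈ s.powerset, coeff n ((-1 : PowerSeries ℤ) ^ t.card * X ^ (∑ m ∈ t, m)) =
      if ∑ m ∈ t, m = n then (-1) ^ t.card else 0 := by
    intro t _
    rw [show (-1 : PowerSeries ℤ) ^ t.card = C ((-1) ^ t.card) by simp, coeff_C_mul, coeff_X_pow]
    simp [eq_comm]
  rw [Finset.sum_congr rfl h2, ← Finset.sum_filter]
  symm
  refine Finset.sum_bij (fun p _ => p.parts.toFinset) ?_ ?_ ?_ ?_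
  · intro p hp
    obtain ⟨hnd, h4⟩ := (Finset.mem_filter.1 hp).2
    rw [Finset.mem_filter, Finset.mem_powerset]
    refine ⟨fun m hm => ?_, ?_⟩
    · rw [Multiset.mem_toFinset] at hm
      exact (hs m (Nat.Partition.le_of_mem_parts hm)).2 (h4 m hm)
    · rw [Finset.sum, Multiset.toFinset_val, hnd.dedup, Multiset.map_id', p.parts_sum]
  · intro p hp p' hp' h
    have h' := congrArg Finset.val h
    rw [Multiset.toFinset_val, Multiset.toFinset_val, (Finset.mem_filter.1 hp).2.1.dedup,
      (Finset.mem_filter.1 hp').2.1.dedup] at h'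
    exact Nat.Partition.ext h'
  · intro t ht
    obtain ⟨hts, hn⟩ := Finset.mem_filter.1 ht
    rw [Finset.mem_powerset] at hts
    have h4 : ∀ m ∈ t, ¬ 4 ∣ m := fun m hm =>
      (hs m (hn ▸ Finset.single_le_sum (f := fun m => m) (fun _ _ => Nat.zero_le _) hm)).1 (hts hm)
    refine ⟨⟨t.val, fun {m} hm => Nat.pos_of_ne_zero ?_, ?_⟩, ?_, ?_⟩
    · rintro rfl
      exact h4 0 hm (dvd_zero 4)
    · rw [← hn, Finset.sum, Multiset.map_id']
    · exact Finset.mem_filter.2 ⟨Finset.mem_univ _, t.nodup, h4⟩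
    · simp
  · intro p hp
    rw [Multiset.toFinset_card_of_nodup (Finset.mem_filter.1 hp).2.1, length]

/-- An integer not divisible by `4` is either odd or twice an odd number. -/
theorem prod_odd_mul_prod_twice_odd (n : ℕ) :
    coeff n ((∏ m ∈ Finset.range (n + 1), (1 - (X : PowerSeries ℤ) ^ (2 * m + 1))) *
      ∏ m ∈ Finset.range (n + 1), (1 - (X : PowerSeries ℤ) ^ (4 * m + 2))) =
      ∑ p : n.Partition with IsS4 p, (-1) ^ length p := by
  rw [← coeff_prod_one_sub n ((Finset.range (n + 1)).image (fun m => 2 * m + 1) ∪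
    (Finset.range (n + 1)).image (fun m => 4 * m + 2)), Finset.prod_union,
    Finset.prod_image, Finset.prod_image]
  · intro a _ b _ h
    simpa using h
  · intro a _ b _ h
    simpa using h
  · rw [Finset.disjoint_left]
    simp only [Finset.mem_image]
    rintro _ ⟨a, -, rfl⟩ ⟨b, -, h⟩
    lia
  · intro m hm
    simp only [Finset.mem_union, Finset.mem_image, Finset.mem_range]
    constructor
    · rintro (⟨a, -, rfl⟩ | ⟨a, -, rfl⟩) <;> lia
    · intro h
      by_cases h2 : m % 2 = 1
      · exact .inl ⟨m / 2, by lia, by lia⟩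
      · exact .inr ⟨m / 4, by lia, by lia⟩

theorem coeff_sum_listGenFun (n : ℕ) :
    coeff n (∑ k ∈ Finset.range (n + 1), (-1) ^ k * listGenFun (goodLists k)) =
      ∑ p : n.Partition with IsS4 p, (-1) ^ length p := by
  rw [← prod_odd_mul_prod_twice_odd]
  -- Modulo `X^{n+1}` the variable is nilpotent, yet the coefficient of `X^n` survives.
  let I : Ideal (PowerSeries ℤ) := Ideal.span {X ^ (n + 1)}
  let φ := Ideal.Quotient.mk I
  have hq : φ X ^ (n + 1) = 0 := by
    rw [← map_pow]
    exact Ideal.Quotient.eq_zero_iff_mem.2 (Ideal.mem_span_singleton_self _)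
  have key := slater_identity (P := fun k => φ (listGenFun (goodLists k))) hq
    (by simp only [listGenFun_goodLists_zero, map_one]) fun k => by
      simpa only [map_mul, map_add, map_sub, map_one, map_pow] using
        congrArg φ (listGenFun_goodLists_succ k)
  have key' : φ (∑ k ∈ Finset.range (n + 1), (-1) ^ k * listGenFun (goodLists k)) =
      φ ((∏ m ∈ Finset.range (n + 1), (1 - (X : PowerSeries ℤ) ^ (2 * m + 1))) *
      ∏ m ∈ Finset.range (n + 1), (1 - (X : PowerSeries ℤ) ^ (4 * m + 2))) := by
    simpa only [map_mul, map_sum, map_prod, map_sub, map_one, map_pow, map_neg] using key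
  have hmem := Ideal.mem_span_singleton.1 (Ideal.Quotient.eq.1 key')
  rw [X_pow_dvd_iff] at hmem
  rw [← sub_eq_zero, ← map_sub]
  exact hmem n n.lt_succ_self

theorem length_le {n : ℕ} (p : n.Partition) : length p ≤ n := by
  have h := Multiset.card_nsmul_le_sum (s := p.parts) (a := 1) fun _ h => p.parts_pos h
  simpa [p.parts_sum, length] using h

theorem sum_isP4_eq (n : ℕ) : ∑ p : n.Partition with IsP4 p, (-1 : ℤ) ^ length p =
    coeff n (∑ k ∈ Finset.range (n + 1), (-1) ^ k * listGenFun (goodLists k)) := by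
  rw [map_sum, ← Finset.sum_fiberwise_of_maps_to (g := length) (t := Finset.range (n + 1))
    fun p _ => Finset.mem_range.2 (Nat.lt_succ_of_le (length_le p))]
  refine Finset.sum_congr rfl fun k _ => ?_
  rw [show (-1 : PowerSeries ℤ) ^ k = C ((-1) ^ k) by simp, coeff_C_mul, ← card_isP4_length,
    Finset.filter_filter, Finset.sum_congr rfl fun p hp => by rw [(Finset.mem_filter.1 hp).2.2],
    Finset.sum_const, nsmul_eq_mul, mul_comm]

theorem card_even_sub_card_odd {n : ℕ} (Q : n.Partition → Prop) [DecidablePred Q] :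
    ((Finset.univ.filter fun p => Q p ∧ Even (length p)).card : ℤ) -
      ((Finset.univ.filter fun p => Q p ∧ Odd (length p)).card : ℤ) =
      ∑ p : n.Partition with Q p, (-1) ^ length p := by
  rw [← Finset.sum_filter_add_sum_filter_not _ (fun p => Even (length p)), Finset.filter_filter,
    Finset.filter_filter, Finset.sum_congr rfl fun p hp => (Finset.mem_filter.1 hp).2.2.neg_one_pow]
  simp_rw [Nat.not_even_iff_odd]
  rw [Finset.sum_congr (s₁ := Finset.univ.filter fun p => Q p ∧ Odd (length p)) rfl
    fun p hp => (Finset.mem_filter.1 hp).2.2.neg_one_pow]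
  simp [sub_eq_add_neg]

end GapMod4

theorem mainTheorem12 (n : ℕ) :
    ((GapMod4.P4e n).card : ℤ) - ((GapMod4.P4o n).card : ℤ) =
      ((GapMod4.S4e n).card : ℤ) - ((GapMod4.S4o n).card : ℤ) := by
  have hP := GapMod4.card_even_sub_card_odd (n := n) GapMod4.IsP4
  have hS := GapMod4.card_even_sub_card_odd (n := n) GapMod4.IsS4
  rw [GapMod4.sum_isP4_eq, GapMod4.coeff_sum_listGenFun, ← hS] at hP
  exact hP
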